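/- Let $(\bar M,\bar g,\bar J)$ be an indefinite Kähler manifold: $\bar g$ is a smooth semi-Riemannian metric of constant index $q$, $0<q<\dim\bar M$; $\bar J$ is a smooth $(1,1)$-tensor field with $\bar J^2=-I$ and $\bar g(\bar JX,\bar JY)=\bar g(X,Y)$; and $\bar\nabla\bar J=0$, where $\bar\nabla$ is the Levi-Civita connection of $\bar g$. Let $M$ be an (immersed) lightlike submanifold of $\bar M$: with $TM^\perp$ the normal bundle with respect to $\bar g$, the radical distribution $\mathrm{Rad}(TM)=TM\cap TM^\perp$ has constant rank $r\ge 1$. Let $S(TM)$ and $S(TM^\perp)$ be a screen distribution and a screen transversal bundle, i.e. non-degenerate smooth subbundles with $TM=S(TM)\perp \mathrm{Rad}(TM)$ and $TM^\perp=S(TM^\perp)\perp \mathrm{Rad}(TM)$. Let $ltr(TM)$ be a lightlike transversal bundle, i.e. a smooth complement of $\mathrm{Rad}(TM)$ in the orthogonal complement of $S(TM^\perp)$ in $S(TM)^\perp$ such that locally there are smooth frames $\{\xi_i\}$ of $\mathrm{Rad}(TM)$ and $\{N_i\}$ of $ltr(TM)$ with $\bar g(\xi_i,N_j)=\delta_{ij}$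 and $\bar g(N_i,N_j)=0$. Put $tr(TM)=ltr(TM)\perp S(TM^\perp)$, so that $T\bar M|_M=TM\oplus tr(TM)$. For $X,Y\in\Gamma(TM)$ and $W\in\Gamma(tr(TM))$ let $h(X,Y)\in\Gamma(tr(TM))$ be the $tr(TM)$-component of $\bar\nabla_XY$, and let $-A_WX\in\Gamma(TM)$ be the $TM$-component of $\bar\nabla_XW$. Suppose that $M$ is a screen transversal Cauchy–Riemann (STCR) lightlike submanifold, that is: (A) $\mathrm{Rad}(TM)=D_1\oplus D_2$ for smooth subbundles $D_1,D_2$ with $\bar J(D_1)\subset S(TM)$ and $\bar J(D_2)\subset S(TM^\perp)$; (B) $S(TM)=\{\bar JD_1\oplus D'\}\perp D_0$ for smooth subbundles $D_0,D'$, with $D_0$ non-degenerate, $\bar J(D_0)=D_0$ and $\bar J(D')=L_1\perp S$, where $L_1$ and $S$ are smooth subbundles of $ltr(TM)$ and $S(TM^\perp)$, respectively. Let $D=D_0\oplus D_1\oplus\bar JD_1$ and $\tilde D=D_2\oplus\bar JL_1\oplus\bar JS$. Call a distribution $B$ on $M$ integrable if $[X,Y]\in\Gamma(B)$ for all $X,Y\in\Gamma(B)$.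 Then: (i) $D$ is integrable if and only if $h(X,\bar JY)=h(\bar JX,Y)$ for all $X,Y\in\Gamma(D)$; (ii) $\tilde D$ is integrable if and only if $A_{\bar JZ}V=A_{\bar JV}Z$ for all $Z,V\in\Gamma(\tilde D)$. -/

import Mathlib

open scoped Manifold ContDiff
open Bundle

noncomputable section

namespace LightlikeGeometry

/-! ### Linear algebra of indefinite scalar products -/

section LinearAlgebra

variable {V : Type*} [AddCommGroup V] [Module ℝ V]

/-- `A = B ⊕ C`, for subspaces of `V`. -/
def IsDirectSum (A B C : Submodule ℝ V) : Prop :=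
  A = B ⊔ C ∧ Disjoint B C

/-- `A = B ⊥ C`: the sum is direct, and `B` and `C` are orthogonal with respect to `β`. -/
def IsOrthDirectSum (β : LinearMap.BilinForm ℝ V) (A B C : Submodule ℝ V) : Prop :=
  IsDirectSum A B C ∧ ∀ b ∈ B, ∀ c ∈ C, β b c = 0

/-- `β` has index `q`: the largest dimension of a subspace on which `β` is negative definite
is `q`. -/
def HasIndex (β : LinearMap.BilinForm ℝ V) (q : ℕ) : Prop :=
  IsGreatest {d : ℕ | ∃ W : Submodule ℝ V, Module.finrank ℝ W = d ∧
    ∀ w ∈ W, w ≠ 0 → β w w < 0} q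

/-- If `T = S ⊥ R`, where `S` is non-degenerate, `C ⊆ S^⊥` is non-degenerate and `R ⊕ L` is the
orthogonal complement of `C` in `S^⊥`, then `V = T ⊕ (L + C)`. -/
theorem isCompl_of_screen [FiniteDimensional ℝ V] {β : LinearMap.BilinForm ℝ V}
    (hβ : ∀ u v, β u v = β v u) {T S R C L : Submodule ℝ V} (hT : T = S ⊔ R)
    (hS : (β.restrict S).Nondegenerate) (hC : (β.restrict C).Nondegenerate)
    (hCS : C ≤ β.orthogonal S) (hRL : IsDirectSum (β.orthogonal S ⊓ β.orthogonal C) R L) :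
    IsCompl T (L ⊔ C) := by
  have hrefl : β.IsRefl := fun u v h => by rw [hβ]; exact h
  have cS := LinearMap.BilinForm.isCompl_orthogonal_of_restrict_nondegenerate hrefl hS
  have cC := LinearMap.BilinForm.isCompl_orthogonal_of_restrict_nondegenerate hrefl hC
  obtain ⟨hsum, hdisj⟩ := hRL
  have hR : R ≤ β.orthogonal S ⊓ β.orthogonal C := hsum ▸ le_sup_left
  have hL : L ≤ β.orthogonal S ⊓ β.orthogonal C := hsum ▸ le_sup_right
  constructor
  · rw [Submodule.disjoint_def]
    intro u hu hu'
    rw [hT, Submodule.mem_sup] at hu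
    obtain ⟨s, hs, a, ha, rfl⟩ := hu
    obtain ⟨l, hl, c, hc, hlc⟩ := Submodule.mem_sup.1 hu'
    have hs0 : s = 0 := by
      have : s ∈ β.orthogonal S := by
        have h1 : s = (l + c) - a := by rw [hlc]; abel
        rw [h1]
        exact Submodule.sub_mem _ (Submodule.add_mem _ (hL hl).1 (hCS hc)) (hR ha).1
      exact Submodule.disjoint_def.1 cS.disjoint s hs this
    subst hs0
    have hc0 : c = 0 := by
      have : c ∈ β.orthogonal C := by
        have h1 : c = a - l := by rw [zero_add] at hlc; rw [← hlc]; abel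
        rw [h1]
        exact Submodule.sub_mem _ (hR ha).2 (hL hl).2
      exact Submodule.disjoint_def.1 cC.disjoint c hc this
    subst hc0
    rw [zero_add, add_zero] at hlc
    rw [zero_add]
    exact Submodule.disjoint_def.1 hdisj a ha (hlc ▸ hl)
  · rw [codisjoint_iff, eq_top_iff]
    intro u _
    have hu : u ∈ S ⊔ β.orthogonal S := by rw [cS.sup_eq_top]; trivial
    obtain ⟨s, hs, t, ht, rfl⟩ := Submodule.mem_sup.1 hu
    have ht' : t ∈ C ⊔ β.orthogonal C := by rw [cC.sup_eq_top]; trivial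
    obtain ⟨c, hc, w, hw, rfl⟩ := Submodule.mem_sup.1 ht'
    have hw' : w ∈ R ⊔ L := by
      rw [← hsum]
      refine ⟨?_, hw⟩
      have h1 : w = (c + w) - c := by abel
      rw [h1]
      exact Submodule.sub_mem _ ht (hCS hc)
    obtain ⟨a, ha, l, hl, rfl⟩ := Submodule.mem_sup.1 hw'
    have e : s + (c + (a + l)) = (s + a) + (l + c) := by abel
    rw [e]
    refine Submodule.add_mem_sup ?_ (Submodule.add_mem_sup hl hc)
    rw [hT]
    exact Submodule.add_mem_sup hs ha

end LinearAlgebra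

/-! ### Indefinite Kähler manifolds -/

section Ambient

variable {F : Type*} [NormedAddCommGroup F] [NormedSpace ℝ F]
  {N : Type*} [TopologicalSpace N] [ChartedSpace F N]

/-- A smooth semi-Riemannian metric on `N`, of constant index `q` with `0 < q < dim N`. -/
structure SemiRiemannianMetric (F : Type*) [NormedAddCommGroup F] [NormedSpace ℝ F]
    (N : Type*) [TopologicalSpace N] [ChartedSpace F N] [IsManifold 𝓘(ℝ, F) ∞ N] where
  /-- The metric as a tensor field of type `(0, 2)`. -/
  toFun : ∀ p : N, TangentSpace 𝓘(ℝ, F) p →L[ℝ] TangentSpace 𝓘(ℝ, F) p →L[ℝ] ℝ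
  contMDiff : ContMDiff 𝓘(ℝ, F) (𝓘(ℝ, F).prod 𝓘(ℝ, F →L[ℝ] F →L[ℝ] ℝ)) ∞
    (fun p ↦ TotalSpace.mk' (F →L[ℝ] F →L[ℝ] ℝ)
      (E := fun p : N ↦ TangentSpace 𝓘(ℝ, F) p →L[ℝ] TangentSpace 𝓘(ℝ, F) p →L[ℝ] ℝ) p (toFun p))
  symm : ∀ p u v, toFun p u v = toFun p v u
  nondegenerate : ∀ p u, (∀ v, toFun p u v = 0) → u = 0
  /-- The index of the metric. -/
  q : ℕ
  q_pos : 0 < q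
  q_lt : q < Module.finrank ℝ F
  hasIndex : ∀ p, HasIndex
    ((ContinuousLinearMap.coeLM ℝ).comp (toFun p).toLinearMap :
      LinearMap.BilinForm ℝ (TangentSpace 𝓘(ℝ, F) p)) q

/-- The metric at `p`, as a bilinear form on `T_p N`. -/
def SemiRiemannianMetric.form [IsManifold 𝓘(ℝ, F) ∞ N] (g : SemiRiemannianMetric F N) (p : N) :
    LinearMap.BilinForm ℝ (TangentSpace 𝓘(ℝ, F) p) :=
  (ContinuousLinearMap.coeLM ℝ).comp (g.toFun p).toLinearMap

/-- A vector field is differentiable at a point. -/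
def VFDiffAt (X : ∀ p : N, TangentSpace 𝓘(ℝ, F) p) (p : N) [IsManifold 𝓘(ℝ, F) ∞ N] : Prop :=
  MDifferentiableAt 𝓘(ℝ, F) 𝓘(ℝ, F).tangent (fun p' ↦ (⟨p', X p'⟩ : TangentBundle 𝓘(ℝ, F) N)) p

/-- `D` is the Levi-Civita connection of `g`: it is torsion-free and metric. Here `D Y p v` is
`(∇_v Y)(p)`. -/
structure IsLeviCivita [IsManifold 𝓘(ℝ, F) ∞ N] (g : SemiRiemannianMetric F N)
    (D : CovariantDerivative 𝓘(ℝ, F) F (TangentSpace 𝓘(ℝ, F) : N → Type _)) : Prop where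
  torsionFree : ∀ (X Y : ∀ p : N, TangentSpace 𝓘(ℝ, F) p) (p : N), VFDiffAt X p → VFDiffAt Y p →
    D Y p (X p) - D X p (Y p) = VectorField.mlieBracket 𝓘(ℝ, F) X Y p
  metric : ∀ (Y Z : ∀ p : N, TangentSpace 𝓘(ℝ, F) p) (p : N) (v : TangentSpace 𝓘(ℝ, F) p),
    VFDiffAt Y p → VFDiffAt Z p →
    mvfderiv 𝓘(ℝ, F) (fun p' ↦ g.toFun p' (Y p') (Z p')) p v =
      g.toFun p (D Y p v) (Z p) + g.toFun p (Y p) (D Z p v)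

/-- An indefinite Kähler structure on `N`: a semi-Riemannian metric `g` and an almost complex
structure `J` such that `g` is Hermitian and `J` is parallel for the Levi-Civita connection. -/
structure IndefiniteKahlerStructure (F : Type*) [NormedAddCommGroup F] [NormedSpace ℝ F]
    (N : Type*) [TopologicalSpace N] [ChartedSpace F N] [IsManifold 𝓘(ℝ, F) ∞ N] where
  g : SemiRiemannianMetric F N
  /-- The almost complex structure. -/
  J : ∀ p : N, TangentSpace 𝓘(ℝ, F) p →L[ℝ] TangentSpace 𝓘(ℝ, F) p
  J_contMDiff : ContMDiff 𝓘(ℝ, F) (𝓘(ℝ, F).prod 𝓘(ℝ, F →L[ℝ] F)) ∞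
    (fun p ↦ TotalSpace.mk' (F →L[ℝ] F)
      (E := fun p : N ↦ TangentSpace 𝓘(ℝ, F) p →L[ℝ] TangentSpace 𝓘(ℝ, F) p) p (J p))
  J_sq : ∀ p u, J p (J p u) = -u
  hermitian : ∀ p u v, g.toFun p (J p u) (J p v) = g.toFun p u v
  /-- The Levi-Civita connection of `g`. -/
  conn : CovariantDerivative 𝓘(ℝ, F) F (TangentSpace 𝓘(ℝ, F) : N → Type _)
  isLeviCivita : IsLeviCivita g conn
  parallel : ∀ (Y : ∀ p : N, TangentSpace 𝓘(ℝ, F) p) (p : N) (v : TangentSpace 𝓘(ℝ, F) p),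
    VFDiffAt Y p → conn (fun p' ↦ J p' (Y p')) p v = J p (conn Y p v)

end Ambient

/-! ### Bundles and derivatives along a map -/

section Along

variable {E : Type*} [NormedAddCommGroup E] [NormedSpace ℝ E]
  {M : Type*} [TopologicalSpace M] [ChartedSpace E M]
  {F : Type*} [NormedAddCommGroup F] [NormedSpace ℝ F]
  {N : Type*} [TopologicalSpace N] [ChartedSpace F N] [IsManifold 𝓘(ℝ, F) ∞ N]

/-- A section over `U` of `TN` along `f : M → N` is smooth. -/
def SmoothAlongOn (f : M → N) (W : ∀ x : M, TangentSpace 𝓘(ℝ, F) (f x)) (U : Set M) : Prop :=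
  ContMDiffOn 𝓘(ℝ, E) 𝓘(ℝ, F).tangent ∞ (fun x ↦ (⟨f x, W x⟩ : TangentBundle 𝓘(ℝ, F) N)) U

/-- A family of subspaces `B x ⊆ T_{f x} N` is a smooth vector subbundle of `TN` along `f`:
locally it has a smooth frame. -/
def IsSmoothSubbundle (E : Type*) [NormedAddCommGroup E] [NormedSpace ℝ E] [ChartedSpace E M]
    (f : M → N) (B : ∀ x : M, Submodule ℝ (TangentSpace 𝓘(ℝ, F) (f x))) : Prop :=
  ∀ x₀ : M, ∃ U : Set M, IsOpen U ∧ x₀ ∈ U ∧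
    ∃ (k : ℕ) (e : Fin k → ∀ x : M, TangentSpace 𝓘(ℝ, F) (f x)),
      (∀ a, SmoothAlongOn (E := E) f (e a) U) ∧
      ∀ x ∈ U, LinearIndependent ℝ (fun a ↦ e a x) ∧
        Submodule.span ℝ (Set.range fun a ↦ e a x) = B x

/-- The connection `∇` of `N`, acting on sections `W` of `TN` along `f : M → N`:
`derivAlong ∇ f W x v` is `∇_v W ∈ T_{f x} N` for `v ∈ T_x M`. It is written in the local frame
`(e_a)` of `TN` around `f x` given by the preferred trivialization at `f x`: if `W = ∑ w^a e_a`,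
then `∇_v W = ∑ dw^a(v) e_a + ∑ w^a(x) ∇_{df(v)} e_a`. The field `FiberBundle.extend F (W x)` is
`∑ w^a(x) e_a`. -/
def derivAlong (D : CovariantDerivative 𝓘(ℝ, F) F (TangentSpace 𝓘(ℝ, F) : N → Type _))
    (f : M → N) (W : ∀ x : M, TangentSpace 𝓘(ℝ, F) (f x)) (x : M) :
    TangentSpace 𝓘(ℝ, E) x →L[ℝ] TangentSpace 𝓘(ℝ, F) (f x) :=
  let e := trivializationAt F (TangentSpace 𝓘(ℝ, F) : N → Type _) (f x)
  (e.symmL ℝ (f x)).comp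
      (mvfderiv 𝓘(ℝ, E) (fun y ↦ (e ⟨f y, W y⟩).2) x) +
    (D (FiberBundle.extend F (W x)) (f x)).comp (mfderiv 𝓘(ℝ, E) 𝓘(ℝ, F) f x)

end Along

/-! ### Lightlike submanifolds -/

section Submanifold

variable {E : Type*} [NormedAddCommGroup E] [NormedSpace ℝ E]
  {M : Type*} [TopologicalSpace M] [ChartedSpace E M]
  {F : Type*} [NormedAddCommGroup F] [NormedSpace ℝ F]
  {N : Type*} [TopologicalSpace N] [ChartedSpace F N] [IsManifold 𝓘(ℝ, F) ∞ N]

/-- The tangent space of `M` at `x`, as a subspace of `T_{f x} N`. -/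
def tangentOf (E : Type*) [NormedAddCommGroup E] [NormedSpace ℝ E] [ChartedSpace E M]
    (f : M → N) (x : M) : Submodule ℝ (TangentSpace 𝓘(ℝ, F) (f x)) :=
  LinearMap.range (mfderiv 𝓘(ℝ, E) 𝓘(ℝ, F) f x).toLinearMap

/-- The fibre of the normal bundle `TM^⊥` at `x`. -/
def normalOf (E : Type*) [NormedAddCommGroup E] [NormedSpace ℝ E] [ChartedSpace E M]
    (g : SemiRiemannianMetric F N) (f : M → N) (x : M) :
    Submodule ℝ (TangentSpace 𝓘(ℝ, F) (f x)) :=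
  (g.form (f x)).orthogonal (tangentOf E f x)

/-- The fibre of the radical distribution `Rad(TM) = TM ∩ TM^⊥` at `x`. -/
def radOf (E : Type*) [NormedAddCommGroup E] [NormedSpace ℝ E] [ChartedSpace E M]
    (g : SemiRiemannianMetric F N) (f : M → N) (x : M) :
    Submodule ℝ (TangentSpace 𝓘(ℝ, F) (f x)) :=
  tangentOf E f x ⊓ normalOf E g f x

variable (E M) in
/-- A lightlike submanifold `(M, g, S(TM), S(TM^⊥))` of `(N, g)`, with a lightlike transversal
bundle `ltr(TM)`. All bundles over `M` are regarded as subbundles of `TN` along the immersion. -/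
structure LightlikeSubmanifold (g : SemiRiemannianMetric F N) where
  /-- The immersion of `M` into `N`. -/
  f : M → N
  isImmersion : Manifold.IsImmersion 𝓘(ℝ, E) 𝓘(ℝ, F) ∞ f
  /-- The rank of the radical distribution. -/
  r : ℕ
  one_le_r : 1 ≤ r
  rad_rank : ∀ x, Module.finrank ℝ (radOf E g f x) = r
  /-- The screen distribution `S(TM)`. -/
  screen : ∀ x : M, Submodule ℝ (TangentSpace 𝓘(ℝ, F) (f x))
  screen_smooth : IsSmoothSubbundle E f screen
  screen_nondegenerate : ∀ x, ((g.form (f x)).restrict (screen x)).Nondegenerate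
  tangent_eq : ∀ x, IsOrthDirectSum (g.form (f x)) (tangentOf E f x) (screen x) (radOf E g f x)
  /-- The screen transversal bundle `S(TM^⊥)`. -/
  coscreen : ∀ x : M, Submodule ℝ (TangentSpace 𝓘(ℝ, F) (f x))
  coscreen_smooth : IsSmoothSubbundle E f coscreen
  coscreen_nondegenerate : ∀ x, ((g.form (f x)).restrict (coscreen x)).Nondegenerate
  normal_eq : ∀ x, IsOrthDirectSum (g.form (f x)) (normalOf E g f x) (coscreen x) (radOf E g f x)
  /-- The lightlike transversal bundle `ltr(TM)`, a complement of `Rad(TM)` in the orthogonal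
  complement of `S(TM^⊥)` in `S(TM)^⊥`. -/
  ltr : ∀ x : M, Submodule ℝ (TangentSpace 𝓘(ℝ, F) (f x))
  ltr_smooth : IsSmoothSubbundle E f ltr
  ltr_compl : ∀ x, IsDirectSum
    ((g.form (f x)).orthogonal (screen x) ⊓ (g.form (f x)).orthogonal (coscreen x))
    (radOf E g f x) (ltr x)
  /-- Locally, `Rad(TM)` and `ltr(TM)` have smooth frames `(ξ_a)` and `(ν_a)` such that
  `g(ξ_a, ν_b) = δ_ab` and `g(ν_a, ν_b) = 0`. -/
  ltr_frame : ∀ x₀ : M, ∃ U : Set M, IsOpen U ∧ x₀ ∈ U ∧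
    ∃ ξ ν : Fin r → ∀ x : M, TangentSpace 𝓘(ℝ, F) (f x),
      (∀ a, SmoothAlongOn (E := E) f (ξ a) U) ∧ (∀ a, SmoothAlongOn (E := E) f (ν a) U) ∧
      ∀ x ∈ U, Submodule.span ℝ (Set.range fun a ↦ ξ a x) = radOf E g f x ∧
        Submodule.span ℝ (Set.range fun a ↦ ν a x) = ltr x ∧
        ∀ a b, g.toFun (f x) (ξ a x) (ν b x) = (if a = b then 1 else 0) ∧
          g.toFun (f x) (ν a x) (ν b x) = 0

namespace LightlikeSubmanifold

variable {g : SemiRiemannianMetric F N} (L : LightlikeSubmanifold E M g)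

/-- A vector field on `M`, as a section of `TN` along the immersion. -/
def push (X : ∀ x : M, TangentSpace 𝓘(ℝ, E) x) (x : M) : TangentSpace 𝓘(ℝ, F) (L.f x) :=
  mfderiv 𝓘(ℝ, E) 𝓘(ℝ, F) L.f x (X x)

/-- `X ∈ Γ(B)`: `X` is a smooth vector field on `M` with values in `B`, for a family `B` of
subspaces of the tangent spaces of `N` along `M`. -/
def IsSection [IsManifold 𝓘(ℝ, E) ∞ M]
    (B : ∀ x : M, Submodule ℝ (TangentSpace 𝓘(ℝ, F) (L.f x)))
    (X : ∀ x : M, TangentSpace 𝓘(ℝ, E) x) : Prop :=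
  ContMDiff 𝓘(ℝ, E) 𝓘(ℝ, E).tangent ∞ (fun x ↦ (⟨x, X x⟩ : TangentBundle 𝓘(ℝ, E) M)) ∧
    ∀ x, L.push X x ∈ B x

/-- The distribution `B` on `M` is integrable: `[X, Y] ∈ Γ(B)` for all `X, Y ∈ Γ(B)`. -/
def IsIntegrable [IsManifold 𝓘(ℝ, E) ∞ M]
    (B : ∀ x : M, Submodule ℝ (TangentSpace 𝓘(ℝ, F) (L.f x))) : Prop :=
  ∀ X Y : ∀ x : M, TangentSpace 𝓘(ℝ, E) x, L.IsSection B X → L.IsSection B Y →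
    L.IsSection B (VectorField.mlieBracket 𝓘(ℝ, E) X Y)

/-- The transversal bundle `tr(TM) = ltr(TM) ⊥ S(TM^⊥)`. -/
def tr (x : M) : Submodule ℝ (TangentSpace 𝓘(ℝ, F) (L.f x)) :=
  L.ltr x ⊔ L.coscreen x

/-- The decomposition `TN|_M = TM ⊕ tr(TM)`. -/
theorem isCompl_tangent_tr [FiniteDimensional ℝ F] (x : M) :
    IsCompl (tangentOf E L.f x) (L.tr x) := by
  have : FiniteDimensional ℝ (TangentSpace 𝓘(ℝ, F) (L.f x)) :=
    inferInstanceAs (FiniteDimensional ℝ F)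
  refine isCompl_of_screen (β := g.form (L.f x)) (fun u v => g.symm _ u v) (L.tangent_eq x).1.1
    (L.screen_nondegenerate x) (L.coscreen_nondegenerate x) ?_ (L.ltr_compl x)
  intro c hc
  have hc' : c ∈ normalOf E g L.f x := by
    rw [(L.normal_eq x).1.1]; exact Submodule.mem_sup_left hc
  intro s hs
  refine hc' s ?_
  rw [(L.tangent_eq x).1.1]; exact Submodule.mem_sup_left hs

variable [FiniteDimensional ℝ F]

/-- The transversal component of `u ∈ T_{f x} N` in `TN|_M = TM ⊕ tr(TM)`. -/
def trPart (x : M) (u : TangentSpace 𝓘(ℝ, F) (L.f x)) : TangentSpace 𝓘(ℝ, F) (L.f x) :=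
  ((L.tr x).projectionOnto (tangentOf E L.f x) (L.isCompl_tangent_tr x).symm u :
    TangentSpace 𝓘(ℝ, F) (L.f x))

/-- The vector of `T_x M` whose image in `T_{f x} N` is the tangential component of `u` in
`TN|_M = TM ⊕ tr(TM)`. -/
def tanPart (x : M) (u : TangentSpace 𝓘(ℝ, F) (L.f x)) : TangentSpace 𝓘(ℝ, E) x :=
  Classical.choose
    ((tangentOf E L.f x).projectionOnto (L.tr x) (L.isCompl_tangent_tr x) u).2

/-- The second fundamental form `h(X, Y)`: the transversal component of `∇_X Y`, where `∇` is the
connection `D` of `N`. -/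
def secondFundamentalForm
    (D : CovariantDerivative 𝓘(ℝ, F) F (TangentSpace 𝓘(ℝ, F) : N → Type _))
    (X Y : ∀ x : M, TangentSpace 𝓘(ℝ, E) x) (x : M) : TangentSpace 𝓘(ℝ, F) (L.f x) :=
  L.trPart x (derivAlong D L.f (L.push Y) x (X x))

/-- The shape operator `A_W X` of a section `W` of `tr(TM)`: the vector field on `M` such that
`-A_W X` is the tangential component of `∇_X W`, where `∇` is the connection `D` of `N`. -/
def shapeOperator
    (D : CovariantDerivative 𝓘(ℝ, F) F (TangentSpace 𝓘(ℝ, F) : N → Type _))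
    (W : ∀ x : M, TangentSpace 𝓘(ℝ, F) (L.f x))
    (X : ∀ x : M, TangentSpace 𝓘(ℝ, E) x) (x : M) : TangentSpace 𝓘(ℝ, E) x :=
  -L.tanPart x (derivAlong D L.f W x (X x))

end LightlikeSubmanifold

end Submanifold

/-! ### Screen transversal Cauchy-Riemann lightlike submanifolds -/

section STCR

variable {E : Type*} [NormedAddCommGroup E] [NormedSpace ℝ E]
  {M : Type*} [TopologicalSpace M] [ChartedSpace E M]
  {F : Type*} [NormedAddCommGroup F] [NormedSpace ℝ F]
  {N : Type*} [TopologicalSpace N] [ChartedSpace F N] [IsManifold 𝓘(ℝ, F) ∞ N]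

/-- The image of a subspace of `T_p N` under `J`. -/
def IndefiniteKahlerStructure.mapJ (K : IndefiniteKahlerStructure F N) {p : N}
    (B : Submodule ℝ (TangentSpace 𝓘(ℝ, F) p)) : Submodule ℝ (TangentSpace 𝓘(ℝ, F) p) :=
  B.map (K.J p).toLinearMap

/-- The structure of a screen transversal Cauchy-Riemann (STCR) lightlike submanifold on a
lightlike submanifold `M` of an indefinite Kähler manifold `N`. -/
structure STCRStructure (K : IndefiniteKahlerStructure F N)
    (L : LightlikeSubmanifold E M K.g) where
  D₁ : ∀ x : M, Submodule ℝ (TangentSpace 𝓘(ℝ, F) (L.f x))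
  D₂ : ∀ x : M, Submodule ℝ (TangentSpace 𝓘(ℝ, F) (L.f x))
  D₁_smooth : IsSmoothSubbundle E L.f D₁
  D₂_smooth : IsSmoothSubbundle E L.f D₂
  /-- `Rad(TM) = D₁ ⊕ D₂`. -/
  rad_eq : ∀ x, IsDirectSum (radOf E K.g L.f x) (D₁ x) (D₂ x)
  J_D₁ : ∀ x, K.mapJ (D₁ x) ≤ L.screen x
  J_D₂ : ∀ x, K.mapJ (D₂ x) ≤ L.coscreen x
  D₀ : ∀ x : M, Submodule ℝ (TangentSpace 𝓘(ℝ, F) (L.f x))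
  /-- The distribution `D'`. -/
  D' : ∀ x : M, Submodule ℝ (TangentSpace 𝓘(ℝ, F) (L.f x))
  D₀_smooth : IsSmoothSubbundle E L.f D₀
  D'_smooth : IsSmoothSubbundle E L.f D'
  /-- `S(TM) = {J D₁ ⊕ D'} ⊥ D₀`. -/
  screen_eq : ∀ x, Disjoint (K.mapJ (D₁ x)) (D' x) ∧
    IsOrthDirectSum (K.g.form (L.f x)) (L.screen x) (K.mapJ (D₁ x) ⊔ D' x) (D₀ x)
  D₀_nondegenerate : ∀ x, ((K.g.form (L.f x)).restrict (D₀ x)).Nondegenerate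
  J_D₀ : ∀ x, K.mapJ (D₀ x) = D₀ x
  L₁ : ∀ x : M, Submodule ℝ (TangentSpace 𝓘(ℝ, F) (L.f x))
  S : ∀ x : M, Submodule ℝ (TangentSpace 𝓘(ℝ, F) (L.f x))
  L₁_smooth : IsSmoothSubbundle E L.f L₁
  S_smooth : IsSmoothSubbundle E L.f S
  L₁_le : ∀ x, L₁ x ≤ L.ltr x
  S_le : ∀ x, S x ≤ L.coscreen x
  /-- `J D' = L₁ ⊥ S`. -/
  J_D' : ∀ x, IsOrthDirectSum (K.g.form (L.f x)) (K.mapJ (D' x)) (L₁ x) (S x)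

namespace STCRStructure

variable {K : IndefiniteKahlerStructure F N} {L : LightlikeSubmanifold E M K.g}
  (C : STCRStructure K L)

/-- The invariant distribution `D = D₀ ⊕ D₁ ⊕ J D₁`. -/
def D (x : M) : Submodule ℝ (TangentSpace 𝓘(ℝ, F) (L.f x)) :=
  C.D₀ x ⊔ C.D₁ x ⊔ K.mapJ (C.D₁ x)

/-- The anti-invariant distribution `D₂ ⊕ J L₁ ⊕ J S`. -/
def Dtilde (x : M) : Submodule ℝ (TangentSpace 𝓘(ℝ, F) (L.f x)) :=
  C.D₂ x ⊔ K.mapJ (C.L₁ x) ⊔ K.mapJ (C.S x)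

end STCRStructure

/-- `J X`, as a section of `TN` along the immersion, for a vector field `X` on `M`. -/
def IndefiniteKahlerStructure.applyJ (K : IndefiniteKahlerStructure F N)
    (L : LightlikeSubmanifold E M K.g) (X : ∀ x : M, TangentSpace 𝓘(ℝ, E) x) (x : M) :
    TangentSpace 𝓘(ℝ, F) (L.f x) :=
  K.J (L.f x) (L.push X x)

/-- `J X` as a vector field on `M`, for a vector field `X` on `M` such that `J X` is tangent to `M`
(in general, the tangential component of `J X`). -/
def IndefiniteKahlerStructure.tangentJ [FiniteDimensional ℝ F] (K : IndefiniteKahlerStructure F N)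
    (L : LightlikeSubmanifold E M K.g) (X : ∀ x : M, TangentSpace 𝓘(ℝ, E) x) (x : M) :
    TangentSpace 𝓘(ℝ, E) x :=
  L.tanPart x (K.applyJ L X x)

end STCR

end LightlikeGeometry

end

/-! Everything is read off from one identity. Since the connection is torsion-free and $\bar J$ is
parallel, $\bar\nabla_X\bar JY-\bar\nabla_Y\bar JX=\bar J[X,Y]$ along the immersion. On $D$ the
fields $\bar JX,\bar JY$ are tangent, and by symmetry of $h$ the transversal component of the left
side is $h(X,\bar JY)-h(\bar JX,Y)$ (`secondFundamentalForm_tangentJ_sub`). On $\tilde D$ they are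
transversal, and the tangential component is $A_{\bar JX}Y-A_{\bar JY}X$
(`shapeOperator_applyJ_sub`).

Algebra finishes the argument: $TM=D\oplus\tilde D$, with $\bar J D\subset TM$ and $\bar J\tilde
D\subset tr(TM)$. Hence for tangent $u$, $\bar Ju$ is tangent iff $u\in D$ and transversal iff
$u\in\tilde D$ (`J_mem_tangent_iff`, `J_mem_tr_iff`). With $u=[X,Y]$, both equivalences hold pair by
pair and point by point.

The analytic work is to carry torsion-freeness and $\bar\nabla\bar J=0$ from fields on $N$ to
sections along a map (`derivAlong_mfderiv_sub`, `derivAlong_J`), by computing in a coordinate frame.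
-/

noncomputable section

namespace LightlikeGeometry

/-! ### Covariant derivatives in a local frame. -/

section Frame

variable {F : Type*} [NormedAddCommGroup F] [NormedSpace ℝ F]
  {N : Type*} [TopologicalSpace N] [ChartedSpace F N] [IsManifold 𝓘(ℝ, F) ∞ N]

/-- The flat connection of the frame given by a trivialization. -/
theorem isCovariantDerivativeOn_flat
    (e : Trivialization F (TotalSpace.proj : TangentBundle 𝓘(ℝ, F) N → N))
    [MemTrivializationAtlas e] :
    IsCovariantDerivativeOn (I := 𝓘(ℝ, F)) F
      (fun (σ : ∀ p : N, TangentSpace 𝓘(ℝ, F) p) (p : N) ↦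
        (e.symmL ℝ p).comp (mvfderiv 𝓘(ℝ, F) (fun q ↦ (e ⟨q, σ q⟩).2) p)) e.baseSet where
  add {σ σ' p} hσ hσ' hp := by
    have h1 := (e.mdifferentiableAt_section_iff 𝓘(ℝ, F) σ hp).1 hσ
    have h2 := (e.mdifferentiableAt_section_iff 𝓘(ℝ, F) σ' hp).1 hσ'
    have : (fun q ↦ (e ⟨q, (σ + σ') q⟩).2) =ᶠ[nhds p]
        (fun q ↦ (e ⟨q, σ q⟩).2) + fun q ↦ (e ⟨q, σ' q⟩).2 := by
      filter_upwards [e.open_baseSet.mem_nhds hp] with q hq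
      exact (e.linear ℝ hq).map_add _ _
    rw [← ContinuousLinearMap.comp_add, ← mvfderiv_add h1 h2]
    simp only [mvfderiv, this.mfderiv_eq]
    rfl
  leibniz {σ g p} hσ hg hp := by
    have h1 := (e.mdifferentiableAt_section_iff 𝓘(ℝ, F) σ hp).1 hσ
    have : (fun q ↦ (e ⟨q, (g • σ) q⟩).2) =ᶠ[nhds p]
        g • (fun q ↦ (e ⟨q, σ q⟩).2) := by
      filter_upwards [e.open_baseSet.mem_nhds hp] with q hq
      exact (e.linear ℝ hq).map_smul _ _
    have h3 : mvfderiv 𝓘(ℝ, F) (fun q ↦ (e ⟨q, (g • σ) q⟩).2) p =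
        mvfderiv 𝓘(ℝ, F) (g • (fun q ↦ (e ⟨q, σ q⟩).2)) p := by
      simp only [mvfderiv, this.mfderiv_eq]
      rfl
    -- This identifies the derivative-of-$g$ term of the product rule with $dg\otimes\sigma$.
    have h4 : e.symmL ℝ p (e ⟨p, σ p⟩).2 = σ p := by
      have := e.symmL_continuousLinearMapAt (R := ℝ) hp (σ p)
      rwa [e.continuousLinearMapAt_apply_of_mem ℝ hp] at this
    rw [h3, mvfderiv_smul hg h1]
    ext v
    simp [h4]

/-- The covariant derivative in the frame given by the preferred trivialization at `p`. -/
theorem covariantDerivative_eq_frame [FiniteDimensional ℝ F]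
    (D : CovariantDerivative 𝓘(ℝ, F) F (TangentSpace 𝓘(ℝ, F) : N → Type _))
    {σ : ∀ p : N, TangentSpace 𝓘(ℝ, F) p} {p : N} (hσ : VFDiffAt σ p) :
    D σ p = ((trivializationAt F (TangentSpace 𝓘(ℝ, F) : N → Type _) p).symmL ℝ p).comp
        (mvfderiv 𝓘(ℝ, F)
          (fun q ↦ (trivializationAt F (TangentSpace 𝓘(ℝ, F) : N → Type _) p ⟨q, σ q⟩).2) p) +
      D (FiberBundle.extend F (σ p)) p := by
  set e := trivializationAt F (TangentSpace 𝓘(ℝ, F) : N → Type _) p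
  have hp : p ∈ e.baseSet := FiberBundle.mem_baseSet_trivializationAt' p
  have hD := D.isCovariantDerivativeOn (s := e.baseSet)
  have hext : VFDiffAt (FiberBundle.extend F (σ p)) p := FiberBundle.mdifferentiableAt_extend ..
  -- The difference of two connections is tensorial, so it agrees on `σ` and on the extension of `σ
  -- p`, which have the same value at `p`. The flat connection kills the extension, whose components
  -- are constant.
  have h1 := hD.difference_apply (isCovariantDerivativeOn_flat e) hp hσ
  have h2 := hD.difference_apply (isCovariantDerivativeOn_flat e) hp hext
  rw [FiberBundle.extend_apply_self, h1] at h2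
  have h3 : (fun q ↦ (e ⟨q, FiberBundle.extend F (σ p) q⟩).2) =ᶠ[nhds p]
      fun _ ↦ (e ⟨p, σ p⟩).2 := by
    filter_upwards [e.open_baseSet.mem_nhds hp] with q hq
    change (e ⟨q, e.symm q (e ⟨p, σ p⟩).2⟩).2 = _
    rw [e.apply_mk_symm hq]
  have h4 : mvfderiv 𝓘(ℝ, F) (fun q ↦ (e ⟨q, FiberBundle.extend F (σ p) q⟩).2) p = 0 := by
    rw [← mvfderiv_const (I := 𝓘(ℝ, F)) (e ⟨p, σ p⟩).2 (x := p)]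
    simp only [mvfderiv, h3.mfderiv_eq]
    rfl
  rw [h4, ContinuousLinearMap.comp_zero, sub_zero, sub_eq_iff_eq_add] at h2
  rw [h2, add_comm]

end Frame

/-! ### Derivatives of vector-valued functions, Lie brackets and immersions. -/

section Calculus

variable {E : Type*} [NormedAddCommGroup E] [NormedSpace ℝ E]
  {M : Type*} [TopologicalSpace M] [ChartedSpace E M]
  {F : Type*} [NormedAddCommGroup F] [NormedSpace ℝ F]
  {N : Type*} [TopologicalSpace N] [ChartedSpace F N]
  {G : Type*} [NormedAddCommGroup G] [NormedSpace ℝ G]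

theorem mvfderiv_congr_of_eventuallyEq {u v : M → G} {x : M} (h : u =ᶠ[nhds x] v) :
    mvfderiv 𝓘(ℝ, E) u x = mvfderiv 𝓘(ℝ, E) v x := by
  simp only [mvfderiv, h.mfderiv_eq]
  rfl

theorem mvfderiv_comp_mfderiv {u : N → G} {f : M → N} {x : M}
    (hu : MDifferentiableAt 𝓘(ℝ, F) 𝓘(ℝ, G) u (f x))
    (hf : MDifferentiableAt 𝓘(ℝ, E) 𝓘(ℝ, F) f x) :
    mvfderiv 𝓘(ℝ, E) (fun y ↦ u (f y)) x =
      (mvfderiv 𝓘(ℝ, F) u (f x)).comp (mfderiv 𝓘(ℝ, E) 𝓘(ℝ, F) f x) :=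
  mfderiv_comp x hu hf

theorem mvfderiv_clm_apply {G' : Type*} [NormedAddCommGroup G'] [NormedSpace ℝ G']
    {a : M → G →L[ℝ] G'} {w : M → G} {x : M}
    (ha : MDifferentiableAt 𝓘(ℝ, E) 𝓘(ℝ, G →L[ℝ] G') a x)
    (hw : MDifferentiableAt 𝓘(ℝ, E) 𝓘(ℝ, G) w x) (v : TangentSpace 𝓘(ℝ, E) x) :
    mvfderiv 𝓘(ℝ, E) (fun y ↦ a y (w y)) x v =
      a x (mvfderiv 𝓘(ℝ, E) w x v) + mvfderiv 𝓘(ℝ, E) a x v (w x) := by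
  have h : HasMFDerivAt 𝓘(ℝ, E) 𝓘(ℝ, G') (fun y ↦ a y (w y)) x _ :=
    ⟨ha.continuousAt.clm_apply hw.continuousAt,
      ha.hasMFDerivAt.2.clm_apply hw.hasMFDerivAt.2⟩
  refine (congrArg (fun l : E →L[ℝ] G' ↦ l v) h.mfderiv).trans ?_
  -- The product rule in the chart evaluates `a` and `w` at the chart image of `x` pulled back,
  -- which must be identified with `x`.
  have hx : (extChartAt 𝓘(ℝ, E) x).symm (extChartAt 𝓘(ℝ, E) x x) = x := extChartAt_to_inv x
  have h1 : writtenInExtChartAt 𝓘(ℝ, E) 𝓘(ℝ, G →L[ℝ] G') x a (extChartAt 𝓘(ℝ, E) x x) = a x :=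
    congrArg a hx
  have h2 : writtenInExtChartAt 𝓘(ℝ, E) 𝓘(ℝ, G) x w (extChartAt 𝓘(ℝ, E) x x) = w x :=
    congrArg w hx
  change writtenInExtChartAt 𝓘(ℝ, E) 𝓘(ℝ, G →L[ℝ] G') x a (extChartAt 𝓘(ℝ, E) x x)
    (mvfderiv 𝓘(ℝ, E) w x v) + mvfderiv 𝓘(ℝ, E) a x v
      (writtenInExtChartAt 𝓘(ℝ, E) 𝓘(ℝ, G) x w (extChartAt 𝓘(ℝ, E) x x)) = _
  rw [h1, h2]

theorem mvfderiv_eq_fderiv {u : E → G} {z : E} : mvfderiv 𝓘(ℝ, E) u z = fderiv ℝ u z := by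
  rw [mvfderiv, mfderiv_eq_fderiv]
  rfl

/-- The action of the Lie bracket on functions with values in a normed space. -/
theorem mvfderiv_mlieBracket [CompleteSpace E] [IsManifold 𝓘(ℝ, E) ∞ M] {u : M → G}
    {X Y : ∀ x : M, TangentSpace 𝓘(ℝ, E) x} {x : M}
    (hu : ContMDiffAt 𝓘(ℝ, E) 𝓘(ℝ, G) ∞ u x) (hX : VFDiffAt X x) (hY : VFDiffAt Y x) :
    mvfderiv 𝓘(ℝ, E) u x (VectorField.mlieBracket 𝓘(ℝ, E) X Y x) =
      mvfderiv 𝓘(ℝ, E) (fun y ↦ mvfderiv 𝓘(ℝ, E) u y (Y y)) x (X x) -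
        mvfderiv 𝓘(ℝ, E) (fun y ↦ mvfderiv 𝓘(ℝ, E) u y (X y)) x (Y x) := by
  set c := extChartAt 𝓘(ℝ, E) x with hc
  -- Fields and function are moved to the model space, where the claim is the symmetry of the second
  -- derivative of `U`.
  let P : (∀ x : M, TangentSpace 𝓘(ℝ, E) x) → E → E := fun Z ↦
    VectorField.mpullback 𝓘(ℝ, E) 𝓘(ℝ, E) c.symm Z
  let U : E → G := fun z ↦ u (c.symm z)
  have hPd : ∀ Z : (∀ x : M, TangentSpace 𝓘(ℝ, E) x), VFDiffAt Z x →
      DifferentiableAt ℝ (P Z) (c x) := by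
    intro Z hZ
    have := MDifferentiableWithinAt.differentiableWithinAt_mpullbackWithin_vectorField
      (mdifferentiableWithinAt_univ.2 hZ)
    simp only [modelWithCornersSelf_coe, Set.range_id, Set.preimage_univ, Set.inter_univ,
      VectorField.mpullbackWithin_univ] at this
    exact differentiableWithinAt_univ.1 this
  have hU : ContDiffAt ℝ ∞ U (c x) := by
    have h1 : ContMDiffAt 𝓘(ℝ, E) 𝓘(ℝ, E) ∞ c.symm (c x) := by
      simpa only [modelWithCornersSelf_coe, Set.range_id, contMDiffWithinAt_univ] using
        contMDiffWithinAt_extChartAt_symm_range (I := 𝓘(ℝ, E)) (n := ∞) x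
        (mem_extChartAt_target x)
    have h2 : c.symm (c x) = x := extChartAt_to_inv x
    exact (ContMDiffAt.comp_of_eq (g := u) hu h1 h2).contDiffAt
  have hsymm : ∀ z ∈ c.target,
      ContMDiffAt 𝓘(ℝ, E) 𝓘(ℝ, E) ∞ c.symm z := by
    intro z hz
    simpa only [modelWithCornersSelf_coe, Set.range_id, contMDiffWithinAt_univ] using
      contMDiffWithinAt_extChartAt_symm_range (I := 𝓘(ℝ, E)) (n := ∞) x hz
  have hinv : ∀ z ∈ c.target,
      (mfderiv 𝓘(ℝ, E) 𝓘(ℝ, E) c.symm z).IsInvertible := by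
    intro z hz
    simpa only [modelWithCornersSelf_coe, Set.range_id, mfderivWithin_univ] using
      isInvertible_mfderivWithin_extChartAt_symm (I := 𝓘(ℝ, E)) hz
  have hP : ∀ (Z : ∀ x : M, TangentSpace 𝓘(ℝ, E) x), ∀ z ∈ c.target,
      mfderiv 𝓘(ℝ, E) 𝓘(ℝ, E) c.symm z (P Z z) = Z (c.symm z) := by
    intro Z z hz
    exact (hinv z hz).self_apply_inverse _
  -- Differentiability near `x`, not only at `x`, is needed: `hUP` is an identity of germs and gets
  -- differentiated.
  have hnear : ∀ᶠ y in nhds x, ContMDiffAt 𝓘(ℝ, E) 𝓘(ℝ, G) 1 u y :=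
    (contMDiffAt_iff_contMDiffAt_nhds (by simp)).1 (hu.of_le ENat.LEInfty.out)
  have hUP : ∀ (Z : ∀ x : M, TangentSpace 𝓘(ℝ, E) x),
      (fun y ↦ mvfderiv 𝓘(ℝ, E) u y (Z y)) =ᶠ[nhds x] fun y ↦ fderiv ℝ U (c y) (P Z (c y)) := by
    intro Z
    filter_upwards [hnear, extChartAt_source_mem_nhds (I := 𝓘(ℝ, E)) x] with y hy hys
    have hz := c.map_source hys
    have h1 := mvfderiv_comp_mfderiv (u := u) (f := c.symm) (x := c y) (E := E) (F := E)
      (by rw [c.left_inv hys]; exact hy.mdifferentiableAt one_ne_zero)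
      ((hsymm _ hz).mdifferentiableAt (by simp))
    have h2 : mvfderiv 𝓘(ℝ, E) U (c y) (P Z (c y)) =
        mvfderiv 𝓘(ℝ, E) u (c.symm (c y)) (Z (c.symm (c y))) := by
      rw [← hP Z _ hz]
      exact congrArg (fun l : E →L[ℝ] G ↦ l (P Z (c y))) h1
    rw [c.left_inv hys] at h2
    rw [← h2]
    simp only [mvfderiv_eq_fderiv]
    rfl
  have hcx : c x ∈ c.target := mem_extChartAt_target x
  have hcd : MDifferentiableAt 𝓘(ℝ, E) 𝓘(ℝ, E) c x :=
    mdifferentiableAt_extChartAt (mem_chart_source E x)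
  have hdU : DifferentiableAt ℝ (fderiv ℝ U) (c x) :=
    (hU.fderiv_right (m := 1) (one_add_one_eq_two (R := ℕ∞ω) ▸ ENat.LEInfty.out)).differentiableAt one_ne_zero
  have hdc : ∀ (Z : ∀ x : M, TangentSpace 𝓘(ℝ, E) x),
      mfderiv 𝓘(ℝ, E) 𝓘(ℝ, E) c x (Z x) = P Z (c x) := by
    intro Z
    have h1 := mfderivWithin_extChartAt_symm_inverse_apply (I := 𝓘(ℝ, E)) (x := x)
      (Z (c.symm (c x)))
    simp only [modelWithCornersSelf_coe, Set.range_id, mfderivWithin_univ] at h1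
    -- `Z y` and `Z x` live in different fibres; both unfold to `E`, where they can be compared.
    have h2 : ∀ y, y = x → (Z y : E) = Z x := by rintro y rfl; rfl
    rw [mfderiv_extChartAt_self]
    exact (h1.trans (h2 _ (extChartAt_to_inv x))).symm
  have hder : ∀ Z Z' : (∀ x : M, TangentSpace 𝓘(ℝ, E) x), VFDiffAt Z x →
      mvfderiv 𝓘(ℝ, E) (fun y ↦ mvfderiv 𝓘(ℝ, E) u y (Z y)) x (Z' x) =
        fderiv ℝ U (c x) (fderiv ℝ (P Z) (c x) (P Z' (c x))) +
          fderiv ℝ (fderiv ℝ U) (c x) (P Z' (c x)) (P Z (c x)) := by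
    intro Z Z' hZ
    rw [mvfderiv_congr_of_eventuallyEq (hUP Z),
      mvfderiv_comp_mfderiv (u := fun z ↦ fderiv ℝ U z (P Z z)) (F := E)
        (hdU.clm_apply (hPd Z hZ)).mdifferentiableAt hcd]
    change mvfderiv 𝓘(ℝ, E) (fun z ↦ fderiv ℝ U z (P Z z)) (c x)
      (mfderiv 𝓘(ℝ, E) 𝓘(ℝ, E) c x (Z' x)) = _
    rw [hdc, mvfderiv_clm_apply hdU.mdifferentiableAt (hPd Z hZ).mdifferentiableAt]
    simp only [mvfderiv_eq_fderiv]
    rfl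
  have hbr : mvfderiv 𝓘(ℝ, E) u x (VectorField.mlieBracket 𝓘(ℝ, E) X Y x) =
      fderiv ℝ U (c x) (VectorField.lieBracket ℝ (P X) (P Y) (c x)) := by
    have h1 := (hUP (VectorField.mlieBracket 𝓘(ℝ, E) X Y)).self_of_nhds
    dsimp only at h1
    -- The manifold bracket is by definition the pullback under `c` of the bracket of `P X` and `P
    -- Y`; the differential of `c` cancels the inverse in it.
    have h2 (w : E) : mfderiv 𝓘(ℝ, E) 𝓘(ℝ, E) c x
        ((mfderiv 𝓘(ℝ, E) 𝓘(ℝ, E) c x).inverse w) = w :=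
      (isInvertible_mfderiv_extChartAt (mem_extChartAt_source x)).self_apply_inverse w
    rw [h1, ← hdc]
    refine (congrArg (fderiv ℝ U (c x)) (h2 _)).trans ?_
    simp only [modelWithCornersSelf_coe, Set.range_id, Set.preimage_univ, Set.inter_univ,
      VectorField.mpullbackWithin_univ]
    exact congrArg (fun B : E → E ↦ fderiv ℝ U (c x) (B (c x))) VectorField.lieBracketWithin_univ
  rw [hbr, hder _ _ hX, hder _ _ hY, VectorField.lieBracket, map_sub,
    (hU.isSymmSndFDerivAt (by simpa using ENat.LEInfty.out)).eq]
  abel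

/-- An immersion has smooth local left inverses. -/
theorem exists_local_leftInverse [IsManifold 𝓘(ℝ, E) ∞ M] {f : M → N}
    (hf : Manifold.IsImmersion 𝓘(ℝ, E) 𝓘(ℝ, F) ∞ f) (x : M) :
    ∃ (U : Set M) (V : Set N) (P : N → M), IsOpen U ∧ x ∈ U ∧ IsOpen V ∧ Set.MapsTo f U V ∧
      ContMDiffOn 𝓘(ℝ, F) 𝓘(ℝ, E) ∞ P V ∧ ∀ y ∈ U, P (f y) = y := by
  have h := hf.isImmersionAt x
  -- In adapted charts an immersion is $z\mapsto(z,0)$, so projecting to the first factor inverts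
  -- it.
  let a : F →L[ℝ] E := (ContinuousLinearMap.fst ℝ E h.complement).comp (h.equiv.symm : F →L[ℝ] E × h.complement)
  have ha (y : M) (hy : y ∈ h.domChart.source) : a (h.codChart (f y)) = h.domChart y := by
    have hz : h.domChart y ∈ (h.domChart.extend 𝓘(ℝ, E)).target := by
      simpa using h.domChart.map_source hy
    have h1 := h.writtenInCharts hz
    simp [h.domChart.left_inv hy] at h1
    simp [a, h1]
  refine ⟨h.domChart.source, h.codChart.source ∩ h.codChart ⁻¹' (a ⁻¹' h.domChart.target),
    fun q ↦ h.domChart.symm (a (h.codChart q)), h.domChart.open_source, h.mem_domChart_source,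
    h.codChart.continuousOn.isOpen_inter_preimage h.codChart.open_source
      (h.domChart.open_target.preimage a.continuous), ?_, ?_, ?_⟩
  · intro y hy
    refine ⟨h.source_subset_preimage_source hy, ?_⟩
    change a (h.codChart (f y)) ∈ h.domChart.target
    rw [ha y hy]
    exact h.domChart.map_source hy
  · refine (contMDiffOn_symm_of_mem_maximalAtlas h.domChart_mem_maximalAtlas).comp
      (t := h.domChart.target) ?_ fun q hq ↦ hq.2
    exact a.contDiff.contMDiff.comp_contMDiffOn
      ((contMDiffOn_of_mem_maximalAtlas h.codChart_mem_maximalAtlas).mono Set.inter_subset_left)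
  · intro y hy
    change h.domChart.symm (a (h.codChart (f y))) = y
    rw [ha y hy, h.domChart.left_inv hy]

/-- Differentiate $P\circ f=\mathrm{id}$ for a local left inverse $P$. -/
theorem mfderiv_injective_of_isImmersion [IsManifold 𝓘(ℝ, E) ∞ M] {f : M → N}
    (hf : Manifold.IsImmersion 𝓘(ℝ, E) 𝓘(ℝ, F) ∞ f) (x : M) :
    Function.Injective (mfderiv 𝓘(ℝ, E) 𝓘(ℝ, F) f x) := by
  obtain ⟨U, V, P, hU, hx, hV, hUV, hP, hPf⟩ := exists_local_leftInverse hf x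
  have hPd := ((hP (f x) (hUV hx)).contMDiffAt (hV.mem_nhds (hUV hx))).mdifferentiableAt (by simp)
  have h1 := mfderiv_comp x hPd ((hf.contMDiff x).mdifferentiableAt (by simp))
  have h2 : P ∘ f =ᶠ[nhds x] id := by
    filter_upwards [hU.mem_nhds hx] with y hy using hPf y hy
  rw [h2.mfderiv_eq, mfderiv_id] at h1
  intro u v huv
  have h3 (w : TangentSpace 𝓘(ℝ, E) x) : w = mfderiv 𝓘(ℝ, F) 𝓘(ℝ, E) P (f x)
      (mfderiv 𝓘(ℝ, E) 𝓘(ℝ, F) f x w) := congrArg (fun l : E →L[ℝ] E ↦ l w) h1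
  rw [h3 u, h3 v, huv]

end Calculus

/-! ### Torsion and smoothness along maps. -/

section AlongMaps

variable {E : Type*} [NormedAddCommGroup E] [NormedSpace ℝ E]
  {M : Type*} [TopologicalSpace M] [ChartedSpace E M]
  {F : Type*} [NormedAddCommGroup F] [NormedSpace ℝ F]
  {N : Type*} [TopologicalSpace N] [ChartedSpace F N] [IsManifold 𝓘(ℝ, F) ∞ N]

/-- The frame used in `derivAlong` is a coordinate frame. This is what lets torsion be computed by
letting brackets act on coordinate functions. -/
theorem trivializationAt_snd_eq_mvfderiv {p q : N} (hq : q ∈ (chartAt F p).source)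
    (v : TangentSpace 𝓘(ℝ, F) q) :
    (trivializationAt F (TangentSpace 𝓘(ℝ, F) : N → Type _) p ⟨q, v⟩).2 =
      mvfderiv 𝓘(ℝ, F) (extChartAt 𝓘(ℝ, F) p) q v := by
  have h := TangentBundle.continuousLinearMapAt_trivializationAt (I := 𝓘(ℝ, F)) hq
  rw [← Trivialization.continuousLinearMapAt_apply_of_mem ℝ _ hq]
  exact congrArg (fun l : F →L[ℝ] F ↦ l v) h

theorem symmL_trivializationAt_snd {p : N} (v : TangentSpace 𝓘(ℝ, F) p) :
    (trivializationAt F (TangentSpace 𝓘(ℝ, F) : N → Type _) p).symmL ℝ p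
      (trivializationAt F (TangentSpace 𝓘(ℝ, F) : N → Type _) p ⟨p, v⟩).2 = v := by
  have hp := FiberBundle.mem_baseSet_trivializationAt' (F := F)
    (E := (TangentSpace 𝓘(ℝ, F) : N → Type _)) p
  rw [← Trivialization.continuousLinearMapAt_apply_of_mem ℝ _ hp]
  exact Trivialization.symmL_continuousLinearMapAt _ hp v

theorem trivializationAt_extend_snd {p q : N} (hq : q ∈ (chartAt F p).source)
    (v : TangentSpace 𝓘(ℝ, F) p) :
    (trivializationAt F (TangentSpace 𝓘(ℝ, F) : N → Type _) p ⟨q, FiberBundle.extend F v q⟩).2 =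
      (trivializationAt F (TangentSpace 𝓘(ℝ, F) : N → Type _) p ⟨p, v⟩).2 := by
  set e := trivializationAt F (TangentSpace 𝓘(ℝ, F) : N → Type _) p
  change (e ⟨q, e.symm q (e ⟨p, v⟩).2⟩).2 = _
  rw [e.apply_mk_symm hq]

/-- The coordinate fields of a chart commute. -/
theorem mlieBracket_extend [CompleteSpace F] (p : N) (v w : TangentSpace 𝓘(ℝ, F) p) :
    VectorField.mlieBracket 𝓘(ℝ, F) (FiberBundle.extend F v) (FiberBundle.extend F w) p = 0 := by
  have hext (u : TangentSpace 𝓘(ℝ, F) p) : VFDiffAt (FiberBundle.extend F u) p :=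
    FiberBundle.mdifferentiableAt_extend ..
  have hconst (u : TangentSpace 𝓘(ℝ, F) p) :
      mvfderiv 𝓘(ℝ, F) (fun q ↦ mvfderiv 𝓘(ℝ, F) (extChartAt 𝓘(ℝ, F) p) q
        (FiberBundle.extend F u q)) p = 0 := by
    rw [← mvfderiv_const (I := 𝓘(ℝ, F))
      (trivializationAt F (TangentSpace 𝓘(ℝ, F) : N → Type _) p ⟨p, u⟩).2 (x := p)]
    apply mvfderiv_congr_of_eventuallyEq
    filter_upwards [(chartAt F p).open_source.mem_nhds (mem_chart_source F p)] with q hq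
    rw [← trivializationAt_snd_eq_mvfderiv hq]
    exact trivializationAt_extend_snd hq _
  have h := mvfderiv_mlieBracket (contMDiffAt_extChartAt (n := ∞)) (hext v) (hext w)
  rw [hconst, hconst, ← trivializationAt_snd_eq_mvfderiv (mem_chart_source F p)] at h
  have h' := symmL_trivializationAt_snd
    (VectorField.mlieBracket 𝓘(ℝ, F) (FiberBundle.extend F v) (FiberBundle.extend F w) p)
  rw [h] at h'
  simpa using h'.symm

theorem derivAlong_apply (D : CovariantDerivative 𝓘(ℝ, F) F (TangentSpace 𝓘(ℝ, F) : N → Type _))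
    (f : M → N) (W : ∀ x : M, TangentSpace 𝓘(ℝ, F) (f x)) (x : M) (v : TangentSpace 𝓘(ℝ, E) x) :
    derivAlong D f W x v =
      (trivializationAt F (TangentSpace 𝓘(ℝ, F) : N → Type _) (f x)).symmL ℝ (f x)
        (mvfderiv 𝓘(ℝ, E) (fun y ↦
          (trivializationAt F (TangentSpace 𝓘(ℝ, F) : N → Type _) (f x) ⟨f y, W y⟩).2) x v) +
      D (FiberBundle.extend F (W x)) (f x) (mfderiv 𝓘(ℝ, E) 𝓘(ℝ, F) f x v) :=
  rfl

/-- A torsion-free connection has no torsion along maps. -/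
theorem derivAlong_mfderiv_sub [CompleteSpace E] [IsManifold 𝓘(ℝ, E) ∞ M] [CompleteSpace F]
    {g : SemiRiemannianMetric F N}
    {D : CovariantDerivative 𝓘(ℝ, F) F (TangentSpace 𝓘(ℝ, F) : N → Type _)}
    (hD : IsLeviCivita g D) {f : M → N} (hf : ContMDiff 𝓘(ℝ, E) 𝓘(ℝ, F) ∞ f)
    {X Y : ∀ x : M, TangentSpace 𝓘(ℝ, E) x} {x : M} (hX : VFDiffAt X x) (hY : VFDiffAt Y x) :
    derivAlong D f (fun y ↦ mfderiv 𝓘(ℝ, E) 𝓘(ℝ, F) f y (Y y)) x (X x) -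
      derivAlong D f (fun y ↦ mfderiv 𝓘(ℝ, E) 𝓘(ℝ, F) f y (X y)) x (Y x) =
      mfderiv 𝓘(ℝ, E) 𝓘(ℝ, F) f x (VectorField.mlieBracket 𝓘(ℝ, E) X Y x) := by
  have hfd (y : M) : MDifferentiableAt 𝓘(ℝ, E) 𝓘(ℝ, F) f y := (hf y).mdifferentiableAt (by simp)
  have hsrc := (chartAt F (f x)).open_source.mem_nhds (mem_chart_source F (f x))
  -- The components of $df(v)$ are the derivatives along $v$ of the coordinates of $f$, so the frame
  -- parts of the two covariant derivatives differ by $[X,Y]$ acting on these coordinates.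
  have hcoord (y : M) (hy : f y ∈ (chartAt F (f x)).source) (v : TangentSpace 𝓘(ℝ, E) y) :
      (trivializationAt F (TangentSpace 𝓘(ℝ, F) : N → Type _) (f x)
        ⟨f y, mfderiv 𝓘(ℝ, E) 𝓘(ℝ, F) f y v⟩).2 =
      mvfderiv 𝓘(ℝ, E) (fun z ↦ extChartAt 𝓘(ℝ, F) (f x) (f z)) y v := by
    rw [trivializationAt_snd_eq_mvfderiv hy,
      mvfderiv_comp_mfderiv (mdifferentiableAt_extChartAt hy) (hfd y)]
    rfl
  have hev (Z : ∀ x : M, TangentSpace 𝓘(ℝ, E) x) :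
      mvfderiv 𝓘(ℝ, E) (fun y ↦ (trivializationAt F (TangentSpace 𝓘(ℝ, F) : N → Type _) (f x)
        ⟨f y, mfderiv 𝓘(ℝ, E) 𝓘(ℝ, F) f y (Z y)⟩).2) x =
      mvfderiv 𝓘(ℝ, E) (fun y ↦
        mvfderiv 𝓘(ℝ, E) (fun z ↦ extChartAt 𝓘(ℝ, F) (f x) (f z)) y (Z y)) x := by
    apply mvfderiv_congr_of_eventuallyEq
    filter_upwards [(hf x).continuousAt hsrc] with y hy using hcoord y hy (Z y)
  have hu : ContMDiffAt 𝓘(ℝ, E) 𝓘(ℝ, F) ∞ (fun z ↦ extChartAt 𝓘(ℝ, F) (f x) (f z)) x :=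
    (contMDiffAt_extChartAt (n := ∞)).comp x (hf x)
  -- Applied to commuting coordinate fields, this is the symmetry of the Christoffel symbols, so the
  -- connection terms cancel.
  have htor := hD.torsionFree
    (FiberBundle.extend F (mfderiv 𝓘(ℝ, E) 𝓘(ℝ, F) f x (X x)))
    (FiberBundle.extend F (mfderiv 𝓘(ℝ, E) 𝓘(ℝ, F) f x (Y x))) (f x)
    (FiberBundle.mdifferentiableAt_extend ..) (FiberBundle.mdifferentiableAt_extend ..)
  rw [mlieBracket_extend, FiberBundle.extend_apply_self, FiberBundle.extend_apply_self,
    sub_eq_zero] at htor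
  rw [derivAlong_apply, derivAlong_apply, hev, hev, htor, add_sub_add_right_eq_sub, ← map_sub,
    ← mvfderiv_mlieBracket hu hX hY, ← hcoord x (mem_chart_source F (f x)),
    symmL_trivializationAt_snd]

/-- A vector field on the source of an immersion is smooth if its push-forward is. -/
theorem contMDiffAt_of_mfderiv_immersion [IsManifold 𝓘(ℝ, E) ∞ M] {f : M → N}
    (hf : Manifold.IsImmersion 𝓘(ℝ, E) 𝓘(ℝ, F) ∞ f)
    {X : ∀ x : M, TangentSpace 𝓘(ℝ, E) x} {x : M}
    (hX : ContMDiffAt 𝓘(ℝ, E) 𝓘(ℝ, F).tangent ∞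
      (fun y ↦ (⟨f y, mfderiv 𝓘(ℝ, E) 𝓘(ℝ, F) f y (X y)⟩ : TangentBundle 𝓘(ℝ, F) N)) x) :
    ContMDiffAt 𝓘(ℝ, E) 𝓘(ℝ, E).tangent ∞ (fun y ↦ (⟨y, X y⟩ : TangentBundle 𝓘(ℝ, E) M)) x := by
  obtain ⟨U, V, P, hU, hx, hV, hUV, hP, hPf⟩ := exists_local_leftInverse hf x
  -- The tangent map of the local left inverse is smooth and recovers `X` from its push-forward.
  have hT := hP.contMDiffOn_tangentMapWithin (m := ∞) le_rfl hV.uniqueMDiffOn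
  have hopen : IsOpen (TotalSpace.proj ⁻¹' V : Set (TangentBundle 𝓘(ℝ, F) N)) :=
    hV.preimage (FiberBundle.continuous_proj F _)
  have hTx := (hT _ (show (⟨f x, mfderiv 𝓘(ℝ, E) 𝓘(ℝ, F) f x (X x)⟩ : TangentBundle 𝓘(ℝ, F) N) ∈
    TotalSpace.proj ⁻¹' V from hUV hx)).contMDiffAt (hopen.mem_nhds (hUV hx))
  refine (hTx.comp x hX).congr_of_eventuallyEq ?_
  filter_upwards [hU.mem_nhds hx] with y hy
  have hPd := ((hP (f y) (hUV hy)).contMDiffAt (hV.mem_nhds (hUV hy))).mdifferentiableAt (by simp)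
  have h1 := mfderiv_comp y hPd ((hf.contMDiff y).mdifferentiableAt (by simp))
  have h2 : P ∘ f =ᶠ[nhds y] id := by
    filter_upwards [hU.mem_nhds hy] with z hz using hPf z hz
  rw [h2.mfderiv_eq, mfderiv_id] at h1
  have h3 : (mfderivWithin 𝓘(ℝ, F) 𝓘(ℝ, E) P V (f y) (mfderiv 𝓘(ℝ, E) 𝓘(ℝ, F) f y (X y)) : E) =
      X y := by
    rw [mfderivWithin_of_isOpen hV (hUV hy)]
    exact (congrArg (fun l : E →L[ℝ] E ↦ l (X y)) h1).symm
  have h4 : ∀ (z : M) (v : E), z = y → v = X y →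
      (⟨z, v⟩ : TangentBundle 𝓘(ℝ, E) M) = ⟨y, X y⟩ := by rintro z v rfl rfl; rfl
  exact (h4 _ _ (hPf y hy) h3).symm

end AlongMaps

/-! ### Parallelism of the complex structure along maps. -/

section Parallel

variable {E : Type*} [NormedAddCommGroup E] [NormedSpace ℝ E]
  {M : Type*} [TopologicalSpace M] [ChartedSpace E M]
  {F : Type*} [NormedAddCommGroup F] [NormedSpace ℝ F] [FiniteDimensional ℝ F]
  {N : Type*} [TopologicalSpace N] [ChartedSpace F N] [IsManifold 𝓘(ℝ, F) ∞ N]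

/-- The almost complex structure is parallel along maps. -/
theorem derivAlong_J (K : IndefiniteKahlerStructure F N) {f : M → N}
    {W : ∀ x : M, TangentSpace 𝓘(ℝ, F) (f x)} {x : M}
    (hW : MDifferentiableAt 𝓘(ℝ, E) 𝓘(ℝ, F).tangent
      (fun y ↦ (⟨f y, W y⟩ : TangentBundle 𝓘(ℝ, F) N)) x) (v : TangentSpace 𝓘(ℝ, E) x) :
    derivAlong K.conn f (fun y ↦ K.J (f y) (W y)) x v = K.J (f x) (derivAlong K.conn f W x v) := by
  set e := trivializationAt F (TangentSpace 𝓘(ℝ, F) : N → Type _) (f x)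
  obtain ⟨hf, hw⟩ := (mdifferentiableAt_totalSpace _ _).1 hW
  -- The matrix of `K.J` in the frame.
  let j : N → F →L[ℝ] F := fun q ↦ (e.continuousLinearMapAt ℝ q).comp ((K.J q).comp (e.symmL ℝ q))
  have hj : MDifferentiableAt 𝓘(ℝ, F) 𝓘(ℝ, F →L[ℝ] F) j (f x) :=
    ((contMDiffAt_hom_bundle _).1 (K.J_contMDiff (f x))).2.mdifferentiableAt (by simp)
  have hjJ (q : N) (hq : q ∈ (chartAt F (f x)).source) (w : TangentSpace 𝓘(ℝ, F) q) :
      (e ⟨q, K.J q w⟩).2 = j q (e ⟨q, w⟩).2 := by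
    have h1 : e.symmL ℝ q (e ⟨q, w⟩).2 = w := by
      rw [← e.continuousLinearMapAt_apply_of_mem ℝ hq]
      exact e.symmL_continuousLinearMapAt hq w
    change _ = e.continuousLinearMapAt ℝ q (K.J q (e.symmL ℝ q (e ⟨q, w⟩).2))
    rw [h1, e.continuousLinearMapAt_apply_of_mem ℝ hq]
  have hsrc := (chartAt F (f x)).open_source.mem_nhds (mem_chart_source F (f x))
  have hJ (a : F) : e.symmL ℝ (f x) (j (f x) a) = K.J (f x) (e.symmL ℝ (f x) a) :=
    e.symmL_continuousLinearMapAt (mem_chart_source F (f x)) _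
  have hJW : mvfderiv 𝓘(ℝ, E) (fun y ↦ (e ⟨f y, K.J (f y) (W y)⟩).2) x v =
      j (f x) (mvfderiv 𝓘(ℝ, E) (fun y ↦ (e ⟨f y, W y⟩).2) x v) +
        mvfderiv 𝓘(ℝ, F) j (f x) (mfderiv 𝓘(ℝ, E) 𝓘(ℝ, F) f x v) (e ⟨f x, W x⟩).2 := by
    have h1 : mvfderiv 𝓘(ℝ, E) (fun y ↦ (e ⟨f y, K.J (f y) (W y)⟩).2) x =
        mvfderiv 𝓘(ℝ, E) (fun y ↦ j (f y) (e ⟨f y, W y⟩).2) x := by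
      apply mvfderiv_congr_of_eventuallyEq
      filter_upwards [hf.continuousAt hsrc] with y hy using hjJ (f y) hy (W y)
    rw [h1, mvfderiv_clm_apply (a := fun y ↦ j (f y)) (hj.comp x hf) hw]
    congr 1
    exact congrArg (fun l : E →L[ℝ] F →L[ℝ] F ↦ l v (e ⟨f x, W x⟩).2) (mvfderiv_comp_mfderiv hj hf)
  have hext : VFDiffAt (FiberBundle.extend F (W x)) (f x) :=
    FiberBundle.mdifferentiableAt_extend ..
  have hσ : VFDiffAt (fun q ↦ K.J q (FiberBundle.extend F (W x) q)) (f x) :=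
    MDifferentiableAt.clm_bundle_apply ((K.J_contMDiff (f x)).mdifferentiableAt (by simp)) hext
  -- Parallelism applied to a field with constant components: the derivative of `j` is exactly the
  -- failure of the connection terms to commute with `K.J`. It absorbs the extra term in `hJW`.
  have hconn (u : TangentSpace 𝓘(ℝ, F) (f x)) :
      K.J (f x) (K.conn (FiberBundle.extend F (W x)) (f x) u) =
      e.symmL ℝ (f x) (mvfderiv 𝓘(ℝ, F) j (f x) u (e ⟨f x, W x⟩).2) +
        K.conn (FiberBundle.extend F (K.J (f x) (W x))) (f x) u := by
    have h1 : mvfderiv 𝓘(ℝ, F) (fun q ↦ (e ⟨q, K.J q (FiberBundle.extend F (W x) q)⟩).2) (f x) =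
        mvfderiv 𝓘(ℝ, F) (fun q ↦ j q (e ⟨f x, W x⟩).2) (f x) := by
      apply mvfderiv_congr_of_eventuallyEq
      filter_upwards [hsrc] with q hq
      rw [hjJ q hq]
      exact congrArg (j q) (trivializationAt_extend_snd hq _)
    have h2 : mvfderiv 𝓘(ℝ, F) (fun q ↦ j q (e ⟨f x, W x⟩).2) (f x) u =
        mvfderiv 𝓘(ℝ, F) j (f x) u (e ⟨f x, W x⟩).2 := by
      rw [mvfderiv_clm_apply hj mdifferentiableAt_const, mvfderiv_const]
      simp
    rw [← K.parallel _ _ _ hext, covariantDerivative_eq_frame K.conn hσ, FiberBundle.extend_apply_self,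
      h1]
    change e.symmL ℝ (f x) (mvfderiv 𝓘(ℝ, F) (fun q ↦ j q (e ⟨f x, W x⟩).2) (f x) u) + _ = _
    rw [h2]
    rfl
  rw [derivAlong_apply, derivAlong_apply, map_add, hconn, hJW, map_add, hJ, add_assoc]

end Parallel

/-! ### Linear algebra: detecting the summands of $TM$ through $\bar J$. -/

section InvariantDecomposition

variable {V : Type*} [AddCommGroup V] [Module ℝ V] {J : V →ₗ[ℝ] V} {T R A B : Submodule ℝ V}

/-- Write $u=a+b$. As $Ja\in T$, having $Ju\in T$ forces $Jb\in T\cap R=0$, so $b=0$ by injectivity.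
-/
theorem mem_of_map_mem_left (hJ : Function.Injective J) (hTR : Disjoint T R) (hT : T ≤ A ⊔ B)
    (hA : A.map J ≤ T) (hB : B.map J ≤ R) {u : V} (hu : u ∈ T) : J u ∈ T ↔ u ∈ A := by
  refine ⟨fun h ↦ ?_, fun h ↦ hA (Submodule.mem_map_of_mem h)⟩
  obtain ⟨a, ha, b, hb, rfl⟩ := Submodule.mem_sup.1 (hT hu)
  have h1 : J b ∈ T := by
    have := T.sub_mem h (hA (Submodule.mem_map_of_mem ha))
    rwa [map_add, add_sub_cancel_left] at this
  have h2 : J b = 0 := Submodule.disjoint_def.1 hTR _ h1 (hB (Submodule.mem_map_of_mem hb))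
  rw [map_eq_zero_iff J hJ] at h2
  rwa [h2, add_zero]

theorem mem_of_map_mem_right (hJ : Function.Injective J) (hTR : Disjoint T R) (hT : T ≤ A ⊔ B)
    (hA : A.map J ≤ T) (hB : B.map J ≤ R) {u : V} (hu : u ∈ T) : J u ∈ R ↔ u ∈ B := by
  refine ⟨fun h ↦ ?_, fun h ↦ hB (Submodule.mem_map_of_mem h)⟩
  obtain ⟨a, ha, b, hb, rfl⟩ := Submodule.mem_sup.1 (hT hu)
  have h1 : J a ∈ R := by
    have := R.sub_mem h (hB (Submodule.mem_map_of_mem hb))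
    rwa [map_add, add_sub_cancel_right] at this
  have h2 : J a = 0 := Submodule.disjoint_def.1 hTR _ (hA (Submodule.mem_map_of_mem ha)) h1
  rw [map_eq_zero_iff J hJ] at h2
  rwa [h2, zero_add]

end InvariantDecomposition

/-! ### The splitting $TM=D\oplus\tilde D$ of an STCR lightlike submanifold. -/

variable {E : Type*} [NormedAddCommGroup E] [NormedSpace ℝ E]
  {M : Type*} [TopologicalSpace M] [ChartedSpace E M]
  {F : Type*} [NormedAddCommGroup F] [NormedSpace ℝ F]
  {N : Type*} [TopologicalSpace N] [ChartedSpace F N] [IsManifold 𝓘(ℝ, F) ∞ N]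

theorem IndefiniteKahlerStructure.J_injective (K : IndefiniteKahlerStructure F N) (p : N) :
    Function.Injective (K.J p) := by
  intro u v h
  rw [← neg_inj, ← K.J_sq, ← K.J_sq, h]

theorem IndefiniteKahlerStructure.mapJ_mapJ (K : IndefiniteKahlerStructure F N) {p : N}
    (B : Submodule ℝ (TangentSpace 𝓘(ℝ, F) p)) : K.mapJ (K.mapJ B) = B := by
  ext u
  constructor
  · rintro ⟨_, ⟨v, hv, rfl⟩, rfl⟩
    change K.J p (K.J p v) ∈ B
    rw [K.J_sq]
    exact B.neg_mem hv
  · intro hu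
    refine ⟨_, ⟨-u, B.neg_mem hu, rfl⟩, ?_⟩
    change K.J p (K.J p (-u)) = u
    rw [K.J_sq, neg_neg]

namespace STCRStructure

variable {K : IndefiniteKahlerStructure F N} {L : LightlikeSubmanifold E M K.g}
  (C : STCRStructure K L)

/-- Because $\bar J^2=-I$, applying $\bar J$ to $\bar JD'=L_1\oplus S$ gives back $D'$. -/
theorem Dtilde_eq (x : M) : C.Dtilde x = C.D₂ x ⊔ C.D' x := by
  rw [Dtilde, sup_assoc, IndefiniteKahlerStructure.mapJ, IndefiniteKahlerStructure.mapJ,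
    ← Submodule.map_sup, ← (C.J_D' x).1.1]
  congr 1
  exact K.mapJ_mapJ _

theorem tangent_eq_sup (x : M) : tangentOf E L.f x = C.D x ⊔ C.Dtilde x := by
  rw [(L.tangent_eq x).1.1, (C.screen_eq x).2.1.1, (C.rad_eq x).1, Dtilde_eq, D]
  ac_rfl

/-- $\bar J$ preserves $D_0$ and exchanges $D_1$ with $\bar JD_1$. -/
theorem mapJ_D_le (x : M) : (C.D x).map (K.J (L.f x)).toLinearMap ≤ C.D x := by
  rw [D, Submodule.map_sup, Submodule.map_sup]
  refine sup_le (sup_le ?_ le_sup_right) ?_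
  · exact (C.J_D₀ x).le.trans (le_sup_left.trans le_sup_left)
  · exact (K.mapJ_mapJ _).le.trans (le_sup_right.trans le_sup_left)

theorem mapJ_Dtilde_le (x : M) : (C.Dtilde x).map (K.J (L.f x)).toLinearMap ≤ L.tr x := by
  rw [Dtilde_eq, Submodule.map_sup]
  refine sup_le ((C.J_D₂ x).trans le_sup_right) ?_
  exact (C.J_D' x).1.1.le.trans (sup_le_sup (C.L₁_le x) (C.S_le x))

theorem mapJ_D_le_tangent (x : M) :
    (C.D x).map (K.J (L.f x)).toLinearMap ≤ tangentOf E L.f x :=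
  (C.mapJ_D_le x).trans (C.tangent_eq_sup x ▸ le_sup_left)

variable [FiniteDimensional ℝ F]

theorem J_mem_tangent_iff (x : M) {u : TangentSpace 𝓘(ℝ, F) (L.f x)}
    (hu : u ∈ tangentOf E L.f x) : K.J (L.f x) u ∈ tangentOf E L.f x ↔ u ∈ C.D x :=
  mem_of_map_mem_left (J := (K.J (L.f x)).toLinearMap) (K.J_injective _)
    (L.isCompl_tangent_tr x).disjoint (C.tangent_eq_sup x).le (C.mapJ_D_le_tangent x)
    (C.mapJ_Dtilde_le x) hu

theorem J_mem_tr_iff (x : M) {u : TangentSpace 𝓘(ℝ, F) (L.f x)}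
    (hu : u ∈ tangentOf E L.f x) : K.J (L.f x) u ∈ L.tr x ↔ u ∈ C.Dtilde x :=
  mem_of_map_mem_right (J := (K.J (L.f x)).toLinearMap) (K.J_injective _)
    (L.isCompl_tangent_tr x).disjoint (C.tangent_eq_sup x).le (C.mapJ_D_le_tangent x)
    (C.mapJ_Dtilde_le x) hu

end STCRStructure

/-! ### Tangential and transversal projections. -/

namespace LightlikeSubmanifold

variable {g : SemiRiemannianMetric F N} (L : LightlikeSubmanifold E M g)

theorem push_mem (X : ∀ x : M, TangentSpace 𝓘(ℝ, E) x) (x : M) :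
    L.push X x ∈ tangentOf E L.f x :=
  ⟨X x, rfl⟩

theorem contMDiff_push [IsManifold 𝓘(ℝ, E) ∞ M] {X : ∀ x : M, TangentSpace 𝓘(ℝ, E) x}
    (hX : ContMDiff 𝓘(ℝ, E) 𝓘(ℝ, E).tangent ∞ (fun x ↦ (⟨x, X x⟩ : TangentBundle 𝓘(ℝ, E) M))) :
    ContMDiff 𝓘(ℝ, E) 𝓘(ℝ, F).tangent ∞
      (fun x ↦ (⟨L.f x, L.push X x⟩ : TangentBundle 𝓘(ℝ, F) N)) :=
  (L.isImmersion.contMDiff.contMDiff_tangentMap (m := ∞) le_rfl).comp hX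

variable [FiniteDimensional ℝ F]

theorem trPart_sub (x : M) (u v : TangentSpace 𝓘(ℝ, F) (L.f x)) :
    L.trPart x (u - v) = L.trPart x u - L.trPart x v := by
  simp only [trPart, map_sub]
  rfl

theorem trPart_eq_zero_iff (x : M) {u : TangentSpace 𝓘(ℝ, F) (L.f x)} :
    L.trPart x u = 0 ↔ u ∈ tangentOf E L.f x := by
  rw [trPart, ZeroMemClass.coe_eq_zero, Submodule.projectionOnto_apply_eq_zero_iff]

theorem mfderiv_tanPart (x : M) (u : TangentSpace 𝓘(ℝ, F) (L.f x)) :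
    mfderiv 𝓘(ℝ, E) 𝓘(ℝ, F) L.f x (L.tanPart x u) =
      (tangentOf E L.f x).projectionOnto (L.tr x) (L.isCompl_tangent_tr x) u :=
  Classical.choose_spec
    ((tangentOf E L.f x).projectionOnto (L.tr x) (L.isCompl_tangent_tr x) u).2

theorem mfderiv_tanPart_of_mem (x : M) {u : TangentSpace 𝓘(ℝ, F) (L.f x)}
    (hu : u ∈ tangentOf E L.f x) :
    mfderiv 𝓘(ℝ, E) 𝓘(ℝ, F) L.f x (L.tanPart x u) = u := by
  rw [mfderiv_tanPart]
  exact congrArg Subtype.val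
    (Submodule.projectionOnto_apply_left (L.isCompl_tangent_tr x) ⟨u, hu⟩)

variable [IsManifold 𝓘(ℝ, E) ∞ M]

/-- `tanPart` is a chosen preimage under $df$; it is additive because injectivity of $df$ makes the
preimage unique. -/
theorem tanPart_sub (x : M) (u v : TangentSpace 𝓘(ℝ, F) (L.f x)) :
    L.tanPart x (u - v) = L.tanPart x u - L.tanPart x v := by
  apply mfderiv_injective_of_isImmersion L.isImmersion x
  rw [map_sub, mfderiv_tanPart, mfderiv_tanPart, mfderiv_tanPart, map_sub]
  rfl

theorem tanPart_eq_zero_iff (x : M) {u : TangentSpace 𝓘(ℝ, F) (L.f x)} :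
    L.tanPart x u = 0 ↔ u ∈ L.tr x := by
  rw [← (mfderiv_injective_of_isImmersion L.isImmersion x).eq_iff, map_zero, mfderiv_tanPart,
    ZeroMemClass.coe_eq_zero, Submodule.projectionOnto_apply_eq_zero_iff]

end LightlikeSubmanifold

/-! ### The two components of $\bar J[X,Y]$. -/

section Formulas

variable {K : IndefiniteKahlerStructure F N} {L : LightlikeSubmanifold E M K.g}
  {X Y : ∀ x : M, TangentSpace 𝓘(ℝ, E) x}

theorem contMDiff_applyJ [IsManifold 𝓘(ℝ, E) ∞ M]
    (hX : ContMDiff 𝓘(ℝ, E) 𝓘(ℝ, E).tangent ∞ (fun x ↦ (⟨x, X x⟩ : TangentBundle 𝓘(ℝ, E) M))) :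
    ContMDiff 𝓘(ℝ, E) 𝓘(ℝ, F).tangent ∞
      (fun x ↦ (⟨L.f x, K.applyJ L X x⟩ : TangentBundle 𝓘(ℝ, F) N)) := fun x ↦
  ContMDiffAt.clm_bundle_apply
    ((K.J_contMDiff.comp L.isImmersion.contMDiff) x) (L.contMDiff_push hX x)

variable [FiniteDimensional ℝ F]

theorem push_tangentJ (hX : ∀ x, K.applyJ L X x ∈ tangentOf E L.f x) :
    L.push (K.tangentJ L X) = K.applyJ L X :=
  funext fun x ↦ L.mfderiv_tanPart_of_mem x (hX x)

variable [IsManifold 𝓘(ℝ, E) ∞ M]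

/-- Needed so that symmetry of `h` applies to $\bar JX$ as a field on $M$. Its push-forward is $\bar
J$ applied to that of $X$, and smoothness descends through an immersion. -/
theorem contMDiff_tangentJ
    (hX : ContMDiff 𝓘(ℝ, E) 𝓘(ℝ, E).tangent ∞ (fun x ↦ (⟨x, X x⟩ : TangentBundle 𝓘(ℝ, E) M)))
    (hJX : ∀ x, K.applyJ L X x ∈ tangentOf E L.f x) :
    ContMDiff 𝓘(ℝ, E) 𝓘(ℝ, E).tangent ∞
      (fun x ↦ (⟨x, K.tangentJ L X x⟩ : TangentBundle 𝓘(ℝ, E) M)) := by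
  intro x
  apply contMDiffAt_of_mfderiv_immersion L.isImmersion
  have h := contMDiff_applyJ (L := L) hX x
  rw [← push_tangentJ hJX] at h
  exact h

theorem derivAlong_applyJ
    (hX : ContMDiff 𝓘(ℝ, E) 𝓘(ℝ, E).tangent ∞ (fun x ↦ (⟨x, X x⟩ : TangentBundle 𝓘(ℝ, E) M)))
    (x : M) (v : TangentSpace 𝓘(ℝ, E) x) :
    derivAlong K.conn L.f (K.applyJ L X) x v =
      K.J (L.f x) (derivAlong K.conn L.f (L.push X) x v) :=
  derivAlong_J K ((L.contMDiff_push hX x).mdifferentiableAt (by simp)) v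

variable [FiniteDimensional ℝ E]

theorem derivAlong_push_sub
    (hX : ContMDiff 𝓘(ℝ, E) 𝓘(ℝ, E).tangent ∞ (fun x ↦ (⟨x, X x⟩ : TangentBundle 𝓘(ℝ, E) M)))
    (hY : ContMDiff 𝓘(ℝ, E) 𝓘(ℝ, E).tangent ∞ (fun x ↦ (⟨x, Y x⟩ : TangentBundle 𝓘(ℝ, E) M)))
    (x : M) :
    derivAlong K.conn L.f (L.push Y) x (X x) - derivAlong K.conn L.f (L.push X) x (Y x) =
      L.push (VectorField.mlieBracket 𝓘(ℝ, E) X Y) x :=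
  have := FiniteDimensional.complete ℝ E
  have := FiniteDimensional.complete ℝ F
  derivAlong_mfderiv_sub K.isLeviCivita L.isImmersion.contMDiff
    ((hX x).mdifferentiableAt (by simp)) ((hY x).mdifferentiableAt (by simp))

/-- The antisymmetric part is the transversal component of the push-forward of $[X,Y]$, which is
tangent. -/
theorem secondFundamentalForm_symm
    (hX : ContMDiff 𝓘(ℝ, E) 𝓘(ℝ, E).tangent ∞ (fun x ↦ (⟨x, X x⟩ : TangentBundle 𝓘(ℝ, E) M)))
    (hY : ContMDiff 𝓘(ℝ, E) 𝓘(ℝ, E).tangent ∞ (fun x ↦ (⟨x, Y x⟩ : TangentBundle 𝓘(ℝ, E) M)))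
    (x : M) :
    L.secondFundamentalForm K.conn X Y x = L.secondFundamentalForm K.conn Y X x := by
  rw [← sub_eq_zero, LightlikeSubmanifold.secondFundamentalForm,
    LightlikeSubmanifold.secondFundamentalForm, ← L.trPart_sub, derivAlong_push_sub hX hY,
    L.trPart_eq_zero_iff]
  exact L.push_mem _ x

/-- `h(X, JY) - h(JX, Y)` is the transversal component of `J[X, Y]`. -/
theorem secondFundamentalForm_tangentJ_sub
    (hX : ContMDiff 𝓘(ℝ, E) 𝓘(ℝ, E).tangent ∞ (fun x ↦ (⟨x, X x⟩ : TangentBundle 𝓘(ℝ, E) M)))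
    (hY : ContMDiff 𝓘(ℝ, E) 𝓘(ℝ, E).tangent ∞ (fun x ↦ (⟨x, Y x⟩ : TangentBundle 𝓘(ℝ, E) M)))
    (hJX : ∀ x, K.applyJ L X x ∈ tangentOf E L.f x)
    (hJY : ∀ x, K.applyJ L Y x ∈ tangentOf E L.f x) (x : M) :
    L.secondFundamentalForm K.conn X (K.tangentJ L Y) x -
        L.secondFundamentalForm K.conn (K.tangentJ L X) Y x =
      L.trPart x (K.J (L.f x) (L.push (VectorField.mlieBracket 𝓘(ℝ, E) X Y) x)) := by
  -- Symmetry makes $\bar JX$ the differentiated field, so that $\bar J$ can be pulled out of both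
  -- terms.
  rw [secondFundamentalForm_symm (contMDiff_tangentJ hX hJX) hY,
    LightlikeSubmanifold.secondFundamentalForm, LightlikeSubmanifold.secondFundamentalForm,
    push_tangentJ hJX, push_tangentJ hJY, derivAlong_applyJ hX, derivAlong_applyJ hY,
    ← L.trPart_sub, ← map_sub, derivAlong_push_sub hX hY]

/-- `A_{JX} Y - A_{JY} X` is the tangential component of `J[X, Y]`. -/
theorem shapeOperator_applyJ_sub
    (hX : ContMDiff 𝓘(ℝ, E) 𝓘(ℝ, E).tangent ∞ (fun x ↦ (⟨x, X x⟩ : TangentBundle 𝓘(ℝ, E) M)))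
    (hY : ContMDiff 𝓘(ℝ, E) 𝓘(ℝ, E).tangent ∞ (fun x ↦ (⟨x, Y x⟩ : TangentBundle 𝓘(ℝ, E) M)))
    (x : M) :
    L.shapeOperator K.conn (K.applyJ L X) Y x - L.shapeOperator K.conn (K.applyJ L Y) X x =
      L.tanPart x (K.J (L.f x) (L.push (VectorField.mlieBracket 𝓘(ℝ, E) X Y) x)) := by
  rw [LightlikeSubmanifold.shapeOperator, LightlikeSubmanifold.shapeOperator, neg_sub_neg,
    derivAlong_applyJ hX, derivAlong_applyJ hY, ← L.tanPart_sub, ← map_sub,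
    derivAlong_push_sub hX hY]

theorem contMDiff_mlieBracket
    (hX : ContMDiff 𝓘(ℝ, E) 𝓘(ℝ, E).tangent ∞ (fun x ↦ (⟨x, X x⟩ : TangentBundle 𝓘(ℝ, E) M)))
    (hY : ContMDiff 𝓘(ℝ, E) 𝓘(ℝ, E).tangent ∞ (fun x ↦ (⟨x, Y x⟩ : TangentBundle 𝓘(ℝ, E) M))) :
    ContMDiff 𝓘(ℝ, E) 𝓘(ℝ, E).tangent ∞
      (fun x ↦ (⟨x, VectorField.mlieBracket 𝓘(ℝ, E) X Y x⟩ : TangentBundle 𝓘(ℝ, E) M)) :=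
  have := FiniteDimensional.complete ℝ E
  -- At order $\infty$ the bracket loses no derivative, as $\infty+1=\infty$.
  have : IsManifold 𝓘(ℝ, E) ((⊤ : ℕ∞) + 1) M := inferInstanceAs (IsManifold 𝓘(ℝ, E) ∞ M)
  have : IsManifold 𝓘(ℝ, E) (minSmoothness ℝ 2) M := by
    rw [minSmoothness_of_isRCLikeNormedField]; infer_instance
  ContDiff.mlieBracket_vectorField (m := ⊤) (n := ⊤) hX hY (by simp)

end Formulas

end LightlikeGeometry

end

/-! ### The integrability criteria. -/

open LightlikeGeometry in
theorem theorem3p3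
    {E : Type*} [NormedAddCommGroup E] [NormedSpace ℝ E] [FiniteDimensional ℝ E]
    {M : Type*} [TopologicalSpace M] [T2Space M] [SecondCountableTopology M]
    [ChartedSpace E M] [IsManifold 𝓘(ℝ, E) ∞ M]
    {F : Type*} [NormedAddCommGroup F] [NormedSpace ℝ F] [FiniteDimensional ℝ F]
    {N : Type*} [TopologicalSpace N] [T2Space N] [SecondCountableTopology N]
    [ChartedSpace F N] [IsManifold 𝓘(ℝ, F) ∞ N]
    (K : IndefiniteKahlerStructure F N) (L : LightlikeSubmanifold E M K.g)
    (C : STCRStructure K L) :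
    (L.IsIntegrable C.D ↔
      ∀ X Y : ∀ x : M, TangentSpace 𝓘(ℝ, E) x, L.IsSection C.D X → L.IsSection C.D Y →
        L.secondFundamentalForm K.conn X (K.tangentJ L Y) =
          L.secondFundamentalForm K.conn (K.tangentJ L X) Y) ∧
    (L.IsIntegrable C.Dtilde ↔
      ∀ Z V : ∀ x : M, TangentSpace 𝓘(ℝ, E) x, L.IsSection C.Dtilde Z → L.IsSection C.Dtilde V →
        L.shapeOperator K.conn (K.applyJ L Z) V = L.shapeOperator K.conn (K.applyJ L V) Z) := by
  constructor
  · refine forall₄_congr fun X Y hX hY ↦ ?_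
    have hJ {Z : ∀ x : M, TangentSpace 𝓘(ℝ, E) x} (hZ : L.IsSection C.D Z) (x : M) :
        K.applyJ L Z x ∈ tangentOf E L.f x := (C.J_mem_tangent_iff x (L.push_mem Z x)).2 (hZ.2 x)
    -- The bracket is automatically smooth, so only its pointwise membership in $D$ remains to be
    -- characterised.
    refine (and_iff_right (contMDiff_mlieBracket hX.1 hY.1)).trans ?_
    rw [funext_iff]
    refine forall_congr' fun x ↦ ?_
    rw [← sub_eq_zero, secondFundamentalForm_tangentJ_sub hX.1 hY.1 (hJ hX) (hJ hY),
      L.trPart_eq_zero_iff, C.J_mem_tangent_iff x (L.push_mem _ x)]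
  · refine forall₄_congr fun X Y hX hY ↦ ?_
    refine (and_iff_right (contMDiff_mlieBracket hX.1 hY.1)).trans ?_
    rw [funext_iff]
    refine forall_congr' fun x ↦ ?_
    rw [← sub_eq_zero, shapeOperator_applyJ_sub hX.1 hY.1, L.tanPart_eq_zero_iff,
      C.J_mem_tr_iff x (L.push_mem _ x)]
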